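/- A GF(2)-grammar is a quadruple $G=(\Sigma,N,R,S)$ consisting of a finite alphabet $\Sigma$, a finite set $N$ of nonterminal symbols, a finite set $R$ of rules $A\to X_1\odot\dots\odot X_\ell$ with $A\in N$, $\ell\ge 0$ and $X_1,\dots,X_\ell\in\Sigma\cup N$, and an initial symbol $S\in N$, such that in the corresponding ordinary (context-free) grammar $\widehat G$, with rules $A\to X_1\dots X_\ell$, every word $w\in\Sigma^*$ has only finitely many parse trees as $A$, for every $A\in N$. The language generated by $G$ is the set of all words $w\in\Sigma^*$ that have an odd number of parse trees as $S$ in $\widehat G$. An arithmetic progression is a set $\{c+kd : k\ge 0\}$ with integers $c,d\ge 0$; one-term progressions ($d=0$) are allowed. **Theorem.** Let $\mathbb N$ be either $\{0,1,2,\dots\}$ or $\{1,2,3,\dots\}$, let $a\ne b$ be two letters of a finite alphabet $\Sigma$, and let $f:\mathbb N\to\{0,1,2,\dots\}$ be strictly increasing. If the language $L_f=\{a^n b^{f(n)} : n\in\mathbb N\}\subseteq\Sigma^*$ is generated by a GF(2)-grammar over $\Sigma$, then the set $f(\mathbb N)$ is a finite union of arithmetic progressions. -/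

import Mathlib

/-- `ParseForest g [X₁, …, X_ℓ]` is the type of sequences of `ℓ` parse trees of the ordinary
(context-free) grammar `g`, the `i`-th tree having its root labelled by the symbol `X_i`:
a terminal labels a leaf, and a node labelled by a nonterminal `A` carries a rule `A → x` of `g`
together with a sequence of trees whose roots spell out `x`.
In particular `ParseForest g [.nonterminal A]` is the type of parse trees with root `A`. -/
inductive ParseForest {T : Type*} (g : ContextFreeGrammar T) : List (Symbol T g.NT) → Type _
  /-- The empty sequence of trees. -/
  | nil : ParseForest g []
  /-- The first tree is a leaf labelled by the terminal `t`. -/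
  | leaf (t : T) {s : List (Symbol T g.NT)} (rest : ParseForest g s) :
      ParseForest g (.terminal t :: s)
  /-- The root of the first tree is labelled by `A`; the rule `A → x` is applied there. -/
  | node (A : g.NT) (x : List (Symbol T g.NT)) (hx : ⟨A, x⟩ ∈ g.rules)
      (children : ParseForest g x) {s : List (Symbol T g.NT)} (rest : ParseForest g s) :
      ParseForest g (.nonterminal A :: s)

/-- The word spelled out by the leaves, read from left to right. -/
def ParseForest.yield {T : Type*} {g : ContextFreeGrammar T} :
    {s : List (Symbol T g.NT)} → ParseForest g s → List T
  | _, .nil => []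
  | _, .leaf t rest => t :: rest.yield
  | _, .node _ _ _ children rest => children.yield ++ rest.yield

/-- The parse trees of the word `w` as `A` in the ordinary grammar `g`. -/
def parseTrees {T : Type*} (g : ContextFreeGrammar T) (A : g.NT) (w : List T) :
    Set (ParseForest g [.nonterminal A]) :=
  {t | t.yield = w}

/-- A (well-formed) GF(2)-grammar. Syntactically it is the same as the ordinary grammar
`ordinary`; every word is required to have only finitely many parse trees in it. -/
structure GF2Grammar (T : Type*) where
  /-- The corresponding ordinary grammar. -/
  ordinary : ContextFreeGrammar T
  /-- Every word has only finitely many parse trees as each nonterminal. -/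
  finite_parseTrees : ∀ (A : ordinary.NT) (w : List T), (parseTrees ordinary A w).Finite

/-- The language `L_G(A)`: all words with an odd number of parse trees as `A`. -/
def GF2Grammar.languageOf {T : Type*} (G : GF2Grammar T) (A : G.ordinary.NT) : Language T :=
  {w | Odd (parseTrees G.ordinary A w).ncard}

/-- The language described by a GF(2)-grammar is that of its initial symbol. -/
def GF2Grammar.language {T : Type*} (G : GF2Grammar T) : Language T :=
  G.languageOf G.ordinary.initial

/-- The language `L` is described (generated) by some GF(2)-grammar. -/
def IsDescribedByGF2Grammar {T : Type*} (L : Language T) : Prop :=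
  ∃ G : GF2Grammar T, G.language = L

/-- The arithmetic progression `c, c + d, c + 2d, …`; for `d = 0` it is the single number `c`. -/
def arithmeticProgression (c d : ℕ) : Set ℕ :=
  {m | ∃ k : ℕ, m = c + k * d}

/-- `S` is the union of finitely many arithmetic progressions. (Since one-term progressions are
allowed, finite progressions are covered as well.) -/
def IsFiniteUnionOfArithmeticProgressions (S : Set ℕ) : Prop :=
  ∃ P : Finset (ℕ × ℕ), S = ⋃ p ∈ P, arithmeticProgression p.1 p.2

/-! Encode the words `aⁿ bᵐ` of the language by a series `F(x, y)` over GF(2). Cutting each tree at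
the border between the two letters shows that the series of all nonterminals satisfy a linear
system. Its coefficients and inhomogeneous terms are polynomials in `y` and in the one-letter series
`P_A(x)` and `Q_A(y)`, which count parses of `aⁿ` and `bᵐ`. The matrix `1 - J` is invertible because
its constant term is: a cycle of unit steps would give infinitely many trees for one word
(`not_transGen_unitStep`, `det_one_sub_jacobian_ne_zero`).

The one-letter series satisfy the polynomial system of the grammar. Differentiating it gives the
same kind of linear system, so all Kähler differentials vanish and the series are algebraic over `k
= GF(2)(x, y)` (`isAlgebraic_of_grammar`). Hence the field generated over `k` by the `P_A` and `Q_A`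
is already the ring they generate. So `s F` is a finite sum of products `P(x) Q(y)` for some
polynomial `s ≠ 0` (`exists_mul_mem_separable`).

Since `f` is injective, each row and each column of `F`, hence of `s F`, is finite. A finite sum of
products has finitely many distinct rows over GF(2), so `s F` is a polynomial
(`exists_coe_of_mem_separable`) and `F` is rational. Setting `x = 1`, after cancelling powers of `x
- 1`, makes the indicator series of the image of `f` rational over a finite field, hence eventually
periodic. -/

/-! ### Operations on parse forests -/

namespace ParseForest

variable {T : Type*} {g : ContextFreeGrammar T}

/-- Juxtaposition of sequences of parse trees. -/
def append : {s : List (Symbol T g.NT)} → {s' : List (Symbol T g.NT)} → ParseForest g s →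
    ParseForest g s' → ParseForest g (s ++ s')
  | _, _, .nil, f => f
  | _, _, .leaf t rest, f => .leaf t (rest.append f)
  | _, _, .node A x hx children rest, f => .node A x hx children (rest.append f)

/-- The number of inner nodes. -/
def size : {s : List (Symbol T g.NT)} → ParseForest g s → ℕ
  | _, .nil => 0
  | _, .leaf _ rest => rest.size
  | _, .node _ _ _ children rest => children.size + rest.size + 1

@[simp] theorem yield_append {s s' : List (Symbol T g.NT)} (t : ParseForest g s)
    (t' : ParseForest g s') : (t.append t').yield = t.yield ++ t'.yield := by
  induction t with
  | nil => rfl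
  | leaf t rest ih => simp [append, yield, ih]
  | node A x hx children rest _ ih => simp [append, yield, ih]

@[simp] theorem size_append {s s' : List (Symbol T g.NT)} (t : ParseForest g s)
    (t' : ParseForest g s') : (t.append t').size = t.size + t'.size := by
  induction t with
  | nil => simp [append, size]
  | leaf t rest ih => simp [append, size, ih]
  | node A x hx children rest _ ih => simp only [append, size, ih]; ring

/-- A nonempty sequence of trees consists of its first tree and the remaining ones. -/
def consEquiv (g : ContextFreeGrammar T) (X : Symbol T g.NT) (s : List (Symbol T g.NT)) :
    ParseForest g (X :: s) ≃ ParseForest g [X] × ParseForest g s where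
  toFun
    | .leaf t rest => (.leaf t .nil, rest)
    | .node A x hx children rest => (.node A x hx children .nil, rest)
  invFun p := p.1.append p.2
  left_inv
    | .leaf _ _ => rfl
    | .node _ _ _ _ _ => rfl
  right_inv
    | (.leaf _ .nil, _) => rfl
    | (.node _ _ _ _ .nil, _) => rfl

/-- A parse tree consists of the rule applied at the root and the trees below the root. -/
def treeEquiv (g : ContextFreeGrammar T) (A : g.NT) :
    ParseForest g [.nonterminal A] ≃
      Σ x : {x : List (Symbol T g.NT) // ⟨A, x⟩ ∈ g.rules}, ParseForest g x.1 where
  toFun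
    | .node _ x hx children .nil => ⟨⟨x, hx⟩, children⟩
  invFun p := .node A p.1.1 p.1.2 p.2 .nil
  left_inv
    | .node _ _ _ _ .nil => rfl
  right_inv _ := rfl

end ParseForest

open ParseForest

/-! ### Counting parses; acyclicity of unit steps -/

section Counting

variable {T : Type*} {g : ContextFreeGrammar T}

/-- The number of sequences of parse trees with roots `s` that spell out `w`. -/
noncomputable def forestCount (g : ContextFreeGrammar T) (s : List (Symbol T g.NT)) (w : List T) :
    ℕ :=
  Nat.card {t : ParseForest g s // t.yield = w}

/-- Pairs of sequences of trees spelling out `w` together, sorted by where `w` is cut. -/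
def yieldSplitEquiv (s s' : List (Symbol T g.NT)) (w : List T) :
    {p : ParseForest g s × ParseForest g s' // p.1.yield ++ p.2.yield = w} ≃
      Σ i : Fin (w.length + 1), {t : ParseForest g s // t.yield = w.take i} ×
        {t : ParseForest g s' // t.yield = w.drop i} where
  toFun p := ⟨⟨p.1.1.yield.length, by
      have := congrArg List.length p.2
      rw [List.length_append] at this; omega⟩,
    ⟨p.1.1, by simp [← p.2]⟩, ⟨p.1.2, by simp [← p.2]⟩⟩
  invFun q := ⟨(q.2.1.1, q.2.2.1), by rw [q.2.1.2, q.2.2.2, List.take_append_drop]⟩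
  left_inv _ := rfl
  right_inv := by
    rintro ⟨⟨i, hi⟩, ⟨t, ht⟩, ⟨t', ht'⟩⟩
    have : t.yield.length = i := by rw [ht]; simp; omega
    subst this
    rfl

theorem finite_rules (A : g.NT) : Finite {x : List (Symbol T g.NT) // ⟨A, x⟩ ∈ g.rules} :=
  Finite.of_injective (β := g.rules) (fun x => ⟨⟨A, x.1⟩, x.2⟩) fun x y h => by
    simpa [Subtype.ext_iff] using h

theorem finite_forests (hg : ∀ (A : g.NT) (w : List T), (parseTrees g A w).Finite)
    (s : List (Symbol T g.NT)) (w : List T) : Finite {t : ParseForest g s // t.yield = w} := by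
  induction s generalizing w with
  | nil =>
    refine @Subtype.finite _ (@Finite.of_subsingleton _ ⟨fun x y => ?_⟩) _
    cases x; cases y; rfl
  | cons X s ih =>
    have hX : ∀ w, Finite {t : ParseForest g [X] // t.yield = w} := by
      intro w
      cases X with
      | nonterminal A => exact (hg A w).to_subtype
      | terminal a =>
        refine @Subtype.finite _ (@Finite.of_subsingleton _ ⟨fun x y => ?_⟩) _
        cases x with | leaf _ r => cases y with | leaf _ r' => cases r; cases r'; rfl
    exact Finite.of_equiv _ (((yieldSplitEquiv [X] s w).symm.trans
      ((consEquiv g X s).symm.subtypeEquiv fun p => by simp [consEquiv])))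

theorem forestCount_nil (w : List T) [Decidable (w = [])] :
    forestCount g [] w = if w = [] then 1 else 0 := by
  split_ifs with h
  · subst h
    refine Nat.card_eq_one_iff_exists.2 ⟨⟨.nil, rfl⟩, ?_⟩
    rintro ⟨t, _⟩
    cases t; rfl
  · refine @Nat.card_of_isEmpty _ ⟨?_⟩
    rintro ⟨t, ht⟩
    cases t; exact h ht.symm

theorem forestCount_terminal (t : T) (w : List T) [Decidable (w = [t])] :
    forestCount g [.terminal t] w = if w = [t] then 1 else 0 := by
  split_ifs with h
  · subst h
    refine Nat.card_eq_one_iff_exists.2 ⟨⟨.leaf t .nil, rfl⟩, ?_⟩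
    rintro ⟨t, _⟩
    cases t with | leaf _ r => cases r; rfl
  · refine @Nat.card_of_isEmpty _ ⟨?_⟩
    rintro ⟨t, ht⟩
    cases t with | leaf _ r => cases r; exact h ht.symm

theorem forestCount_cons (hg : ∀ (A : g.NT) (w : List T), (parseTrees g A w).Finite)
    (X : Symbol T g.NT) (s : List (Symbol T g.NT)) (w : List T) :
    forestCount g (X :: s) w =
      ∑ i ∈ Finset.range (w.length + 1), forestCount g [X] (w.take i) * forestCount g s (w.drop i) := by
  have := finite_forests hg
  rw [forestCount, ← Nat.card_congr ((yieldSplitEquiv [X] s w).symm.trans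
      ((consEquiv g X s).symm.subtypeEquiv fun p => by simp [consEquiv])), Nat.card_sigma,
    ← Fin.sum_univ_eq_sum_range
      (fun i => forestCount g [X] (w.take i) * forestCount g s (w.drop i))]
  simp [forestCount]

theorem forestCount_nonterminal (hg : ∀ (A : g.NT) (w : List T), (parseTrees g A w).Finite)
    (A : g.NT) [Fintype {x : List (Symbol T g.NT) // ⟨A, x⟩ ∈ g.rules}] (w : List T) :
    forestCount g [.nonterminal A] w =
      ∑ x : {x : List (Symbol T g.NT) // ⟨A, x⟩ ∈ g.rules}, forestCount g x.1 w := by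
  have := finite_forests hg
  have e : {t : ParseForest g [.nonterminal A] // t.yield = w} ≃
      Σ x : {x : List (Symbol T g.NT) // ⟨A, x⟩ ∈ g.rules}, {t : ParseForest g x.1 // t.yield = w} :=
    ((treeEquiv g A).symm.subtypeEquiv (p := fun p => p.2.yield = w) (fun p => by
      simp [treeEquiv, yield])).symm.trans
      { toFun := fun p => ⟨p.1.1, p.1.2, p.2⟩
        invFun := fun p => ⟨⟨p.1, p.2.1⟩, p.2.2⟩
        left_inv := fun _ => rfl
        right_inv := fun _ => rfl }
  rw [forestCount, Nat.card_congr e, Nat.card_sigma]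
  rfl

/-- Some parse tree has its root labelled by `A`. -/
def Productive (g : ContextFreeGrammar T) (A : g.NT) : Prop :=
  Nonempty (ParseForest g [.nonterminal A])

theorem forestCount_of_not_productive {A : g.NT} (hA : ¬ Productive g A) (w : List T) :
    forestCount g [.nonterminal A] w = 0 :=
  @Nat.card_of_isEmpty _ ⟨fun t => hA ⟨t.1⟩⟩

/-- The type of nonterminals may be infinite, but a productive one heads one of the finitely many
rules. This allows finite matrices indexed by productive nonterminals. -/
theorem finite_productive : Finite {A : g.NT // Productive g A} := by
  have : ∀ A : {A : g.NT // Productive g A}, ∃ r : g.rules, r.1.input = A.1 := by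
    rintro ⟨A, ⟨t⟩⟩
    cases t with | node _ x hx _ _ => exact ⟨⟨_, hx⟩, rfl⟩
  choose r hr using this
  exact Finite.of_injective r fun A B h => Subtype.ext (by rw [← hr, ← hr, h])

/-- Every symbol of `s` derives the empty word. -/
def Nullable (g : ContextFreeGrammar T) (s : List (Symbol T g.NT)) : Prop :=
  ∃ t : ParseForest g s, t.yield = []

/-- `A` rewrites in one step to `B` surrounded by symbols deriving the empty word. -/
def UnitStep (g : ContextFreeGrammar T) (A B : g.NT) : Prop :=
  ∃ u v, (⟨A, u ++ .nonterminal B :: v⟩ : ContextFreeRule T g.NT) ∈ g.rules ∧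
    Nullable g u ∧ Nullable g v

theorem UnitStep.exists_tree {A B : g.NT} (h : UnitStep g A B)
    (t : ParseForest g [.nonterminal B]) :
    ∃ t' : ParseForest g [.nonterminal A], t'.yield = t.yield ∧ t.size < t'.size := by
  obtain ⟨u, v, hr, ⟨tu, hu⟩, ⟨tv, hv⟩⟩ := h
  refine ⟨.node A _ hr (tu.append (t.append tv)) .nil, ?_, ?_⟩
  · simp [yield, hu, hv]
  · simp [size]; omega

theorem exists_tree_of_transGen {A B : g.NT} (h : Relation.TransGen (UnitStep g) A B) :
    ∀ t : ParseForest g [.nonterminal B],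
    ∃ t' : ParseForest g [.nonterminal A], t'.yield = t.yield ∧ t.size < t'.size := by
  induction h with
  | single h => exact h.exists_tree
  | tail _ h ih =>
    intro t
    obtain ⟨t', h1, h2⟩ := h.exists_tree t
    obtain ⟨t'', h3, h4⟩ := ih t'
    exact ⟨t'', h3.trans h1, h2.trans h4⟩

/-- Going around a cycle enlarges a tree without changing its yield, contradicting finiteness.
Productivity is essential: a rule `A → A` alone has no parse trees and breaks nothing. -/
theorem not_transGen_unitStep (hg : ∀ (A : g.NT) (w : List T), (parseTrees g A w).Finite)
    {A : g.NT} (hA : Productive g A) : ¬ Relation.TransGen (UnitStep g) A A := by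
  intro h
  obtain ⟨t⟩ := hA
  -- A largest tree with this yield exists; the cycle produces a larger one.
  obtain ⟨m, hm, hmax⟩ := (hg A t.yield).exists_maximalFor ParseForest.size _ ⟨t, rfl⟩
  obtain ⟨t', h1, h2⟩ := exists_tree_of_transGen h m
  have h3 : t' ∈ parseTrees g A t.yield := h1.trans hm
  have := hmax h3 h2.le
  omega

theorem wellFounded_unitStep (hg : ∀ (A : g.NT) (w : List T), (parseTrees g A w).Finite) :
    WellFounded fun B A : {A : g.NT // Productive g A} => UnitStep g A.1 B.1 := by
  have := finite_productive (g := g)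
  let r : {A : g.NT // Productive g A} → {A : g.NT // Productive g A} → Prop :=
    fun B A => Relation.TransGen (UnitStep g) A.1 B.1
  have h1 : Std.Irrefl r := ⟨fun A => not_transGen_unitStep hg A.2⟩
  have h2 : IsTrans _ r := ⟨fun _ _ _ h h' => Relation.TransGen.trans h' h⟩
  exact Subrelation.wf (fun h => Relation.TransGen.single h) (Finite.wellFounded_of_trans_of_irrefl r)

end Counting

/-! ### Twisted derivations on words -/

section Leibniz

variable {σ A V : Type*} [CommRing A] [AddCommGroup V] [Module A V]

/-- The value at a word of the twisted derivation that takes the values `n` at the letters: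
`∑ i, (∏ j < i, p (s j)) • (∏ j > i, q (s j)) • n (s i)`. -/
def leibniz (p q : σ → A) (n : σ → V) : List σ → V
  | [] => 0
  | x :: s => (s.map q).prod • n x + p x • leibniz p q n s

theorem map_leibniz {B : Type*} [CommRing B] (φ : A →+* B) (p q n : σ → A) (s : List σ) :
    φ (leibniz p q n s) = leibniz (φ ∘ p) (φ ∘ q) (φ ∘ n) s := by
  induction s with
  | nil => simp [leibniz]
  | cons x s ih => simp [leibniz, ih, map_list_prod]

/-- Linearity in `n`: the letters in the range of `e` become the unknowns of a linear system, and
`n'` carries the remaining letters into its inhomogeneous term. -/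
theorem leibniz_eq_sum_add [DecidableEq σ] {ι : Type*} [Fintype ι] {e : ι → σ}
    (he : Function.Injective e) (p q : σ → A) (n n' : σ → V) (h0 : ∀ i, n' (e i) = 0)
    (hn : ∀ x, x ∉ Set.range e → n' x = n x) (s : List σ) :
    leibniz p q n s =
      ∑ i, leibniz p q (Pi.single (e i) (1 : A)) s • n (e i) + leibniz p q n' s := by
  induction s with
  | nil => simp [leibniz]
  | cons x s ih =>
    have hx : n x = ∑ i, (Pi.single (e i) (1 : A) : σ → A) x • n (e i) + n' x := by
      by_cases h : x ∈ Set.range e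
      · obtain ⟨j, rfl⟩ := h
        rw [h0, add_zero, Finset.sum_eq_single j]
        · simp
        · intro i _ hij
          rw [Pi.single_eq_of_ne (fun h => hij (he h).symm), zero_smul]
        · simp
      · rw [hn x h, Finset.sum_eq_zero, zero_add]
        intro i _
        rw [Pi.single_eq_of_ne (fun h' => h ⟨i, h'.symm⟩), zero_smul]
    simp only [leibniz, add_smul, Finset.sum_add_distrib, ih, smul_add, Finset.smul_sum, smul_eq_mul,
      mul_smul]
    conv_lhs => rw [hx]
    simp only [smul_add, Finset.smul_sum]
    abel

/-- A nonzero sum has a nonzero term, which singles out one occurrence of `y` with nonzero factors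
on both sides. With `z` counting empty parses, this is how a nonzero Jacobian entry yields a unit
step. -/
theorem exists_split_of_leibniz_ne_zero [NoZeroDivisors A] [DecidableEq σ] {z : σ → A} {y : σ}
    {s : List σ} (h : leibniz z z (Pi.single y (1 : A)) s ≠ 0) :
    ∃ u v, s = u ++ y :: v ∧ (∀ x ∈ u, z x ≠ 0) ∧ ∀ x ∈ v, z x ≠ 0 := by
  induction s with
  | nil => exact absurd rfl h
  | cons x s ih =>
    by_cases h1 : z x • leibniz z z (Pi.single y (1 : A)) s = 0
    · rw [leibniz, h1, add_zero, smul_eq_mul] at h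
      have hx : x = y := by
        by_contra hxy
        exact h (by rw [Pi.single_eq_of_ne hxy, mul_zero])
      refine ⟨[], s, by simp [hx], by simp, fun x hx h0 => left_ne_zero_of_mul h ?_⟩
      exact List.prod_eq_zero (List.mem_map.2 ⟨x, hx, h0⟩)
    · obtain ⟨u, v, rfl, hu, hv⟩ := ih (right_ne_zero_of_mul h1)
      refine ⟨x :: u, v, rfl, ?_, hv⟩
      simpa using ⟨left_ne_zero_of_mul h1, hu⟩

theorem derivation_list_prod {k : Type*} [CommRing k] [Algebra k A] [Module k V]
    (D : Derivation k A V) (S : σ → A) (s : List σ) :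
    D (s.map S).prod = leibniz S S (fun x => D (S x)) s := by
  induction s with
  | nil => simp [leibniz]
  | cons x s ih => simp only [List.map_cons, List.prod_cons, Derivation.leibniz, ih, leibniz]; abel

end Leibniz

/-! ### The Jacobian of a grammar and its invertibility -/

section Jacobian

variable {T : Type*} {g : ContextFreeGrammar T}

theorem nullable_of_forall {s : List (Symbol T g.NT)} (h : ∀ x ∈ s, Nullable g [x]) :
    Nullable g s := by
  induction s with
  | nil => exact ⟨.nil, rfl⟩
  | cons x s ih =>
    obtain ⟨t, ht⟩ := h x (by simp)
    obtain ⟨t', ht'⟩ := ih fun y hy => h y (by simp [hy])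
    exact ⟨t.append t', (yield_append t t').trans (by rw [ht, ht', List.append_nil])⟩

noncomputable instance (A : g.NT) : Fintype {x : List (Symbol T g.NT) // ⟨A, x⟩ ∈ g.rules} :=
  @Fintype.ofFinite _ (finite_rules A)

noncomputable instance : Fintype {A : g.NT // Productive g A} :=
  @Fintype.ofFinite _ finite_productive

noncomputable instance : DecidableEq (Symbol T g.NT) := Classical.decEq _

noncomputable instance : DecidableEq {A : g.NT // Productive g A} := Classical.decEq _

/-- The matrix of the linear system satisfied by twisted derivatives of the nonterminals. -/
noncomputable def jacobian (g : ContextFreeGrammar T) {A : Type*} [CommRing A]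
    (p q : Symbol T g.NT → A) : Matrix {A : g.NT // Productive g A} {A : g.NT // Productive g A} A :=
  fun X Y => ∑ x : {x : List (Symbol T g.NT) // ⟨X.1, x⟩ ∈ g.rules},
    leibniz p q (Pi.single (.nonterminal Y.1) 1) x.1

theorem map_jacobian {A B : Type*} [CommRing A] [CommRing B] (φ : A →+* B)
    (p q : Symbol T g.NT → A) : (jacobian g p q).map φ = jacobian g (φ ∘ p) (φ ∘ q) := by
  ext X Y
  simp only [Matrix.map_apply, jacobian, map_sum, map_leibniz]
  refine Finset.sum_congr rfl fun x _ => ?_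
  congr 1
  ext y
  by_cases h : y = .nonterminal Y.1
  · subst h; simp
  · simp [Pi.single_eq_of_ne h]

/-- Used both for field embeddings and for the constant-term map, through which nonvanishing of the
determinant is checked. -/
theorem map_det_one_sub_jacobian {A B : Type*} [CommRing A] [CommRing B] (φ : A →+* B)
    (p q : Symbol T g.NT → A) :
    φ (1 - jacobian g p q).det = (1 - jacobian g (φ ∘ p) (φ ∘ q)).det := by
  rw [RingHom.map_det, map_sub, map_one, RingHom.mapMatrix_apply, map_jacobian]

/-- A nonzero entry of the Jacobian forces a unit step, and unit steps are well-founded on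
productive nonterminals. A vector in the kernel of `1 - J` therefore vanishes by induction. -/
theorem det_one_sub_jacobian_ne_zero {F : Type*} [Field F]
    (hg : ∀ (A : g.NT) (w : List T), (parseTrees g A w).Finite) (z : Symbol T g.NT → F)
    (hz : ∀ x, z x ≠ 0 → Nullable g [x]) : (1 - jacobian g z z).det ≠ 0 := by
  intro h
  obtain ⟨v, hv, h⟩ := Matrix.exists_mulVec_eq_zero_iff.2 h
  refine hv (funext fun X => ?_)
  induction X using (wellFounded_unitStep hg).induction with
  | _ X ih =>
    have hX : v X = ∑ Y, jacobian g z z X Y * v Y := by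
      have := congrFun h X
      rw [Matrix.sub_mulVec, Matrix.one_mulVec, Pi.sub_apply, Pi.zero_apply, sub_eq_zero] at this
      exact this
    rw [hX]
    refine Finset.sum_eq_zero fun Y _ => ?_
    by_cases hXY : UnitStep g X.1 Y.1
    · rw [ih Y hXY, Pi.zero_apply, mul_zero]
    · rw [jacobian, Finset.sum_eq_zero, zero_mul]
      intro x _
      by_contra hx
      obtain ⟨u, w, hs, hu, hw⟩ := exists_split_of_leibniz_ne_zero hx
      exact hXY ⟨u, w, hs ▸ x.2, nullable_of_forall fun y hy => hz y (hu y hy),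
        nullable_of_forall fun y hy => hz y (hw y hy)⟩

/-- One linear system serves two purposes: `n` is either a Kähler differential with `p = q`, or the
two-letter series with `p` and `q` the one-letter series. -/
theorem system_eq {A V : Type*} [CommRing A] [AddCommGroup V] [Module A V]
    (p q : Symbol T g.NT → A) (n n' : Symbol T g.NT → V)
    (hn : ∀ X : {A : g.NT // Productive g A}, n (.nonterminal X.1) =
      ∑ x : {x : List (Symbol T g.NT) // ⟨X.1, x⟩ ∈ g.rules}, leibniz p q n x.1)
    (h0 : ∀ X, n' (.nonterminal X) = 0) (ht : ∀ t, n' (.terminal t) = n (.terminal t))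
    (hu : ∀ X, ¬ Productive g X → n (.nonterminal X) = 0) (X : {A : g.NT // Productive g A}) :
    n (.nonterminal X.1) = ∑ Y, jacobian g p q X Y • n (.nonterminal Y.1) +
      ∑ x : {x : List (Symbol T g.NT) // ⟨X.1, x⟩ ∈ g.rules}, leibniz p q n' x.1 := by
  rw [hn X]
  simp only [jacobian, Finset.sum_smul]
  rw [Finset.sum_comm, ← Finset.sum_add_distrib]
  refine Finset.sum_congr rfl fun x _ => ?_
  refine leibniz_eq_sum_add (e := fun Y : {A : g.NT // Productive g A} => .nonterminal Y.1)
    (fun X Y h => Subtype.ext (Symbol.nonterminal.inj h)) p q n n' (fun i => h0 _) ?_ _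
  rintro (t | Y) hY
  · exact ht t
  · rw [h0, hu]
    exact fun h => hY ⟨⟨Y, h⟩, rfl⟩

end Jacobian

/-! ### Linear systems with invertible matrix -/

section LinearSystems

variable {ι : Type*} [Fintype ι] [DecidableEq ι]

theorem eq_zero_of_eq_sum_smul {k V : Type*} [Field k] [AddCommGroup V] [Module k V]
    {J : Matrix ι ι k} (hJ : (1 - J).det ≠ 0) {n : ι → V} (hn : ∀ i, n i = ∑ j, J i j • n j)
    (i : ι) : n i = 0 := by
  have h : ∀ i, ∑ j, (1 - J) i j • n j = 0 := by
    intro i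
    simp only [Matrix.sub_apply, sub_smul, Finset.sum_sub_distrib, ← hn i, Matrix.one_apply,
      ite_smul, one_smul, zero_smul, Finset.sum_ite_eq, Finset.mem_univ, if_true, sub_self]
  have h1 : (1 - J)⁻¹ * (1 - J) = 1 := Matrix.nonsing_inv_mul _ (isUnit_iff_ne_zero.2 hJ)
  calc n i = ∑ j, ((1 - J)⁻¹ * (1 - J)) i j • n j := by
        simp [h1, Matrix.one_apply]
    _ = ∑ l, (1 - J)⁻¹ i l • ∑ j, (1 - J) l j • n j := by
        simp only [Matrix.mul_apply, Finset.sum_smul, Finset.smul_sum, mul_smul]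
        exact Finset.sum_comm
    _ = 0 := Finset.sum_eq_zero fun l _ => by rw [h, smul_zero]

/-- The system can be solved inside `E`, since the determinant is nonzero there too; uniqueness over
`K` identifies the two solutions. -/
theorem mem_of_eq_sum_add {k K : Type*} [Field k] [Field K] [Algebra k K]
    (E : IntermediateField k K) {J : Matrix ι ι K} (hJ : (1 - J).det ≠ 0) {n c : ι → K}
    (hn : ∀ i, n i = ∑ j, J i j * n j + c i) (hJE : ∀ i j, J i j ∈ E) (hc : ∀ i, c i ∈ E)
    (i : ι) : n i ∈ E := by
  let J' : Matrix ι ι E := fun i j => ⟨J i j, hJE i j⟩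
  let c' : ι → E := fun i => ⟨c i, hc i⟩
  have hJ' : (1 - J').det ≠ 0 := by
    intro h
    refine hJ ?_
    have := congrArg (algebraMap E K) h
    rw [RingHom.map_det, map_sub, map_one, map_zero] at this
    exact this
  let n' : ι → E := (1 - J')⁻¹.mulVec c'
  have h1 : (1 - J').mulVec n' = c' := by
    rw [Matrix.mulVec_mulVec, Matrix.mul_nonsing_inv _ (isUnit_iff_ne_zero.2 hJ'),
      Matrix.one_mulVec]
  have h2 : ∀ i, n' i = ∑ j, J' i j * n' j + c' i := by
    intro i
    have := congrFun h1 i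
    rw [Matrix.sub_mulVec, Matrix.one_mulVec, Pi.sub_apply, sub_eq_iff_eq_add'] at this
    exact this
  have h3 : ∀ i, n i - (n' i : K) = 0 := by
    refine eq_zero_of_eq_sum_smul hJ fun i => ?_
    have := congrArg (algebraMap E K) (h2 i)
    simp only [map_add, map_sum, map_mul] at this
    change (n' i : K) = ∑ j, J i j * (n' j : K) + c i at this
    rw [hn i, this]
    simp only [smul_eq_mul, mul_sub, Finset.sum_sub_distrib]
    ring
  rw [sub_eq_zero.1 (h3 i)]
  exact (n' i).2

theorem leibniz_mem {σ A S : Type*} [CommRing A] [SetLike S A] [SubringClass S A] (E : S)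
    {p q n : σ → A} (hp : ∀ x, p x ∈ E) (hq : ∀ x, q x ∈ E) (hn : ∀ x, n x ∈ E) (s : List σ) :
    leibniz p q n s ∈ E := by
  induction s with
  | nil => exact zero_mem E
  | cons x s ih =>
    refine add_mem (mul_mem (list_prod_mem ?_) (hn x)) (mul_mem (hp x) ih)
    intro y hy
    obtain ⟨z, _, rfl⟩ := List.mem_map.1 hy
    exact hq z

theorem jacobian_mem {T : Type*} {g : ContextFreeGrammar T} {A S : Type*} [CommRing A]
    [SetLike S A] [SubringClass S A] (E : S) {p q : Symbol T g.NT → A} (hp : ∀ x, p x ∈ E)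
    (hq : ∀ x, q x ∈ E) (X Y : {A : g.NT // Productive g A}) : jacobian g p q X Y ∈ E := by
  refine sum_mem fun x _ => leibniz_mem E hp hq (fun y => ?_) _
  by_cases h : y = .nonterminal Y.1
  · subst h; rw [Pi.single_eq_same]; exact one_mem E
  · rw [Pi.single_eq_of_ne h]; exact zero_mem E

end LinearSystems

/-! ### Algebraicity of the one-letter series -/

section Algebraicity

/-- A finitely generated field extension without Kähler differentials is separable algebraic. The
hypothesis ranges over all `E`, but is applied only to the field generated by `S`. -/
theorem isAlgebraic_of_derivation_eq_zero {k K ι : Type*} [Field k] [Field K] [Algebra k K]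
    [Finite ι] (S : ι → K)
    (h : ∀ (E : IntermediateField k K) (S' : ι → E), (∀ i, (S' i : K) = S i) →
      ∀ i, KaehlerDifferential.D k E (S' i) = 0) (i : ι) : IsAlgebraic k (S i) := by
  let E := IntermediateField.adjoin k (Set.range S)
  have hE : Algebra.EssFiniteType k E := by
    rw [IntermediateField.essFiniteType_iff]
    exact IntermediateField.fg_adjoin_of_finite (Set.finite_range S)
  have hS : ∀ i, S i ∈ E := fun i => IntermediateField.subset_adjoin _ _ ⟨i, rfl⟩
  have hD := h E (fun i => ⟨S i, hS i⟩) (fun i => rfl)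
  have hall : ∀ x (hx : x ∈ E), KaehlerDifferential.D k E ⟨x, hx⟩ = 0 := by
    intro x hx
    induction hx using IntermediateField.adjoin_induction with
    | mem x hx => obtain ⟨i, rfl⟩ := hx; exact hD i
    | algebraMap x => exact Derivation.map_algebraMap _ x
    | add x y hx hy h1 h2 =>
      have := (KaehlerDifferential.D k E).map_add ⟨x, hx⟩ ⟨y, hy⟩
      rw [h1, h2, add_zero] at this
      exact this
    | inv x hx h1 =>
      have := (KaehlerDifferential.D k E).leibniz_inv ⟨x, hx⟩
      rw [h1, smul_zero] at this
      exact this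
    | mul x y hx hy h1 h2 =>
      have := (KaehlerDifferential.D k E).leibniz ⟨x, hx⟩ ⟨y, hy⟩
      rw [h1, h2, smul_zero, smul_zero, add_zero] at this
      exact this
  have hu : Algebra.FormallyUnramified k E := by
    refine ⟨?_⟩
    rw [← Submodule.subsingleton_iff E, ← subsingleton_iff_bot_eq_top,
      ← KaehlerDifferential.span_range_derivation,
      eq_comm, Submodule.span_eq_bot]
    rintro _ ⟨x, rfl⟩
    exact hall x.1 x.2
  have hs : Algebra.IsSeparable k E := (Algebra.FormallyUnramified.iff_isSeparable k E).1 hu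
  have := Algebra.IsAlgebraic.isAlgebraic (R := k) (⟨S i, hS i⟩ : E)
  exact this.algebraMap (A := K)

/-- Algebraicity in the style of the Jacobian criterion: differentiating the polynomial system gives
a homogeneous linear system with invertible matrix, so every differential is zero. -/
theorem isAlgebraic_of_grammar {T : Type*} {g : ContextFreeGrammar T} {k K : Type*} [Field k]
    [Field K] [Algebra k K] (S : Symbol T g.NT → K)
    (hS : ∀ X : {A : g.NT // Productive g A}, S (.nonterminal X.1) =
      ∑ x : {x : List (Symbol T g.NT) // ⟨X.1, x⟩ ∈ g.rules}, (x.1.map S).prod)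
    (ht : ∀ t, S (.terminal t) ∈ Set.range (algebraMap k K))
    (hu : ∀ X, ¬ Productive g X → S (.nonterminal X) = 0)
    (hdet : (1 - jacobian g S S).det ≠ 0) (x : Symbol T g.NT) : IsAlgebraic k (S x) := by
  have key : ∀ X : {A : g.NT // Productive g A}, IsAlgebraic k (S (.nonterminal X.1)) := by
    refine isAlgebraic_of_derivation_eq_zero _ fun E S₁ hS₁ => ?_
    have hmem : ∀ x, S x ∈ E := by
      rintro (t | X)
      · obtain ⟨y, hy⟩ := ht t
        rw [← hy]; exact E.algebraMap_mem y
      · by_cases hX : Productive g X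
        · rw [← hS₁ ⟨X, hX⟩]; exact (S₁ _).2
        · rw [hu X hX]; exact zero_mem E
    let S' : Symbol T g.NT → E := fun x => ⟨S x, hmem x⟩
    have hS₁' : ∀ X, S₁ X = S' (.nonterminal X.1) := fun X => Subtype.ext (hS₁ X)
    have hdet' : (1 - jacobian g S' S').det ≠ 0 := by
      intro h
      refine hdet ?_
      have := congrArg (algebraMap E K) h
      rw [map_det_one_sub_jacobian, map_zero] at this
      exact this
    simp only [hS₁']
    refine eq_zero_of_eq_sum_smul hdet' fun X => ?_
    -- The inhomogeneous part is `0` because terminals take values in `k`, which `D` kills.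
    have := system_eq S' S' (fun x => KaehlerDifferential.D k E (S' x)) (fun _ => 0) ?_
      (fun _ => rfl) ?_ ?_ X
    · rw [this]
      simp only [add_eq_left]
      refine Finset.sum_eq_zero fun x _ => ?_
      induction x.1 with
      | nil => rfl
      | cons y s ih => simp [leibniz, ih]
    · intro X
      have : S' (.nonterminal X.1) =
          ∑ x : {x : List (Symbol T g.NT) // ⟨X.1, x⟩ ∈ g.rules}, (x.1.map S').prod := by
        refine Subtype.ext ((hS X).trans ?_)
        rw [AddSubmonoidClass.coe_finsetSum]
        refine Finset.sum_congr rfl fun x _ => ?_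
        change _ = algebraMap E K _
        rw [map_list_prod, List.map_map]
        rfl
      simp only [this, map_sum, derivation_list_prod]
    · intro t
      obtain ⟨y, hy⟩ := ht t
      have : S' (.terminal t) = algebraMap k E y := Subtype.ext hy.symm
      rw [this, Derivation.map_algebraMap]
    · intro X hX
      have : S' (.nonterminal X) = 0 := Subtype.ext (hu X hX)
      rw [this, map_zero]
  rcases x with t | X
  · obtain ⟨y, hy⟩ := ht t
    rw [← hy]; exact isAlgebraic_algebraMap y
  · by_cases hX : Productive g X
    · exact key ⟨X, hX⟩
    · rw [hu X hX]; exact isAlgebraic_zero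

end Algebraicity

/-! ### Generating series of a grammar modulo two -/

section Series

variable {T : Type*} {g : ContextFreeGrammar T}

/-- The generating function modulo two of the numbers of parses of the words `aⁿ`. -/
noncomputable def unarySeries (g : ContextFreeGrammar T) (a : T) (s : List (Symbol T g.NT)) :
    PowerSeries (ZMod 2) :=
  PowerSeries.mk fun n => (forestCount g s (List.replicate n a) : ZMod 2)

/-- The generating function modulo two of the numbers of parses of the words `aⁿ bᵐ` with
`0 < m`. The outer variable corresponds to `b`, the inner one to `a`. -/
noncomputable def binarySeries (g : ContextFreeGrammar T) (a b : T) (s : List (Symbol T g.NT)) :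
    PowerSeries (PowerSeries (ZMod 2)) :=
  PowerSeries.mk fun m => PowerSeries.mk fun n =>
    if m = 0 then 0 else (forestCount g s (List.replicate n a ++ List.replicate m b) : ZMod 2)

/-- Power series in the inner variable. -/
noncomputable def innerHom : PowerSeries (ZMod 2) →ₐ[ZMod 2] PowerSeries (PowerSeries (ZMod 2)) :=
  { (PowerSeries.C : PowerSeries (ZMod 2) →+* _) with
    commutes' := fun _ => (PowerSeries.algebraMap_apply).symm }

/-- Power series in the outer variable. -/
noncomputable def outerHom : PowerSeries (ZMod 2) →ₐ[ZMod 2] PowerSeries (PowerSeries (ZMod 2)) :=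
  PowerSeries.mapAlgHom (Algebra.ofId _ _)

theorem innerHom_apply (P : PowerSeries (ZMod 2)) : innerHom P = PowerSeries.C P := rfl

theorem coeff_outerHom (Q : PowerSeries (ZMod 2)) (m : ℕ) :
    PowerSeries.coeff m (outerHom Q) = PowerSeries.C (PowerSeries.coeff m Q) := rfl

theorem outerHom_X : outerHom PowerSeries.X = PowerSeries.X :=
  PowerSeries.map_X _

theorem coeff_coeff_innerHom_mul (P : PowerSeries (ZMod 2)) (G : PowerSeries (PowerSeries (ZMod 2)))
    (n m : ℕ) : PowerSeries.coeff n (PowerSeries.coeff m (innerHom P * G)) =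
      ∑ i ∈ Finset.range (n + 1),
        PowerSeries.coeff i P * PowerSeries.coeff (n - i) (PowerSeries.coeff m G) := by
  rw [innerHom_apply, PowerSeries.coeff_C_mul, PowerSeries.coeff_mul,
    Finset.Nat.sum_antidiagonal_eq_sum_range_succ_mk]

theorem coeff_coeff_mul_outerHom (Q : PowerSeries (ZMod 2)) (G : PowerSeries (PowerSeries (ZMod 2)))
    (n m : ℕ) : PowerSeries.coeff n (PowerSeries.coeff m (G * outerHom Q)) =
      ∑ i ∈ Finset.range (m + 1),
        PowerSeries.coeff n (PowerSeries.coeff i G) * PowerSeries.coeff (m - i) Q := by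
  rw [PowerSeries.coeff_mul, Finset.Nat.sum_antidiagonal_eq_sum_range_succ_mk, map_sum]
  simp only [coeff_outerHom, PowerSeries.coeff_mul_C]

theorem unarySeries_nil (a : T) : unarySeries g a [] = 1 := by
  classical
  ext n
  rw [unarySeries, PowerSeries.coeff_mk, forestCount_nil, PowerSeries.coeff_one]
  simp

theorem unarySeries_cons (hg : ∀ (A : g.NT) (w : List T), (parseTrees g A w).Finite) (a : T)
    (x : Symbol T g.NT) (s : List (Symbol T g.NT)) :
    unarySeries g a (x :: s) = unarySeries g a [x] * unarySeries g a s := by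
  ext n
  rw [PowerSeries.coeff_mul, Finset.Nat.sum_antidiagonal_eq_sum_range_succ_mk]
  simp only [unarySeries, PowerSeries.coeff_mk]
  rw [forestCount_cons hg, List.length_replicate, Nat.cast_sum]
  refine Finset.sum_congr rfl fun i hi => ?_
  rw [Finset.mem_range] at hi
  rw [Nat.cast_mul, List.take_replicate, List.drop_replicate, min_eq_left (by omega)]

theorem unarySeries_eq_prod (hg : ∀ (A : g.NT) (w : List T), (parseTrees g A w).Finite) (a : T)
    (s : List (Symbol T g.NT)) :
    unarySeries g a s = (s.map fun x => unarySeries g a [x]).prod := by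
  induction s with
  | nil => exact unarySeries_nil a
  | cons x s ih => rw [unarySeries_cons hg, ih, List.map_cons, List.prod_cons]

theorem unarySeries_nonterminal (hg : ∀ (A : g.NT) (w : List T), (parseTrees g A w).Finite) (a : T)
    (X : g.NT) : unarySeries g a [.nonterminal X] =
      ∑ x : {x : List (Symbol T g.NT) // ⟨X, x⟩ ∈ g.rules}, unarySeries g a x.1 := by
  ext n
  simp [unarySeries, forestCount_nonterminal hg]

theorem unarySeries_terminal (a t : T) [Decidable (t = a)] :
    unarySeries g a [.terminal t] = if t = a then PowerSeries.X else 0 := by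
  classical
  ext n
  rw [unarySeries, PowerSeries.coeff_mk, forestCount_terminal]
  split_ifs with h1 h2 h2
  · subst h2
    have := congrArg List.length h1
    simp only [List.length_replicate, List.length_singleton] at this
    simp [this]
  · have := congrArg List.length h1
    simp only [List.length_replicate, List.length_singleton] at this
    subst this
    exact absurd (by simpa using h1.symm) h2
  · subst h2
    rw [PowerSeries.coeff_X, if_neg, Nat.cast_zero]
    rintro rfl
    exact h1 rfl
  · simp

theorem unarySeries_of_not_productive (a : T) {X : g.NT} (hX : ¬ Productive g X) :
    unarySeries g a [.nonterminal X] = 0 := by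
  ext n
  simp [unarySeries, forestCount_of_not_productive hX]

theorem constantCoeff_unarySeries (a : T) (s : List (Symbol T g.NT)) :
    PowerSeries.constantCoeff (unarySeries g a s) = (forestCount g s [] : ZMod 2) := by
  rw [← PowerSeries.coeff_zero_eq_constantCoeff_apply, unarySeries, PowerSeries.coeff_mk]
  rfl

theorem nullable_of_forestCount_ne_zero {s : List (Symbol T g.NT)} (h : forestCount g s [] ≠ 0) :
    Nullable g s := by
  by_contra h'
  exact h (@Nat.card_of_isEmpty _ ⟨fun t => h' ⟨t.1, t.2⟩⟩)

theorem coeff_coeff_binarySeries (a b : T) (s : List (Symbol T g.NT)) (n m : ℕ) :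
    PowerSeries.coeff n (PowerSeries.coeff m (binarySeries g a b s)) =
      if m = 0 then 0 else
        (forestCount g s (List.replicate n a ++ List.replicate m b) : ZMod 2) := by
  rw [binarySeries, PowerSeries.coeff_mk, PowerSeries.coeff_mk]

theorem binarySeries_nil (a b : T) : binarySeries g a b [] = 0 := by
  classical
  ext m n
  rw [coeff_coeff_binarySeries, forestCount_nil]
  simp +contextual

/-- The cut after the first tree lies either inside the block of `b`, leaving only letters `b` to
the right, or inside the block of `a` or on the border. Requiring `0 < m` in `binarySeries` counts
the border cut exactly once. -/
theorem binarySeries_cons (hg : ∀ (A : g.NT) (w : List T), (parseTrees g A w).Finite) (a b : T)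
    (x : Symbol T g.NT) (s : List (Symbol T g.NT)) :
    binarySeries g a b (x :: s) = outerHom (unarySeries g b s) * binarySeries g a b [x] +
      innerHom (unarySeries g a [x]) * binarySeries g a b s := by
  ext m n
  rw [mul_comm (outerHom _), map_add, map_add, coeff_coeff_mul_outerHom, coeff_coeff_innerHom_mul]
  simp only [coeff_coeff_binarySeries]
  rcases m with _ | m
  · simp
  rw [if_neg m.succ_ne_zero, forestCount_cons hg, List.length_append, List.length_replicate,
    List.length_replicate, Nat.cast_sum, show n + (m + 1) + 1 = (n + 1) + (m + 1) by omega,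
    Finset.sum_range_add, add_comm]
  congr 1
  -- The peeled-off term has no `b` in the first tree and vanishes by the convention for exponent
  -- `0`; the other terms are the cuts after at least one `b`.
  · rw [Finset.sum_range_succ' _ (m + 1)]
    simp only [if_true, zero_mul, add_zero, if_neg (Nat.succ_ne_zero _)]
    refine Finset.sum_congr rfl fun i hi => ?_
    rw [Finset.mem_range] at hi
    rw [Nat.cast_mul, List.take_append, List.drop_append, List.take_of_length_le (by simp; omega),
      List.drop_of_length_le (by simp; omega), List.length_replicate, List.take_replicate,
      List.drop_replicate, List.nil_append, unarySeries, PowerSeries.coeff_mk,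
      show n + 1 + i - n = i + 1 by omega, min_eq_left (by omega)]
  · refine Finset.sum_congr rfl fun i hi => ?_
    rw [Finset.mem_range] at hi
    rw [Nat.cast_mul, List.take_append, List.drop_append, List.length_replicate,
      show i - n = 0 by omega, List.take_zero, List.drop_zero, List.append_nil,
      List.take_replicate, List.drop_replicate, if_neg m.succ_ne_zero, unarySeries,
      PowerSeries.coeff_mk, min_eq_left (by omega)]

theorem binarySeries_eq_leibniz (hg : ∀ (A : g.NT) (w : List T), (parseTrees g A w).Finite)
    (a b : T) (s : List (Symbol T g.NT)) :
    binarySeries g a b s = leibniz (fun x => innerHom (unarySeries g a [x]))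
      (fun x => outerHom (unarySeries g b [x])) (fun x => binarySeries g a b [x]) s := by
  induction s with
  | nil => exact binarySeries_nil a b
  | cons x s ih =>
    rw [binarySeries_cons hg, leibniz, unarySeries_eq_prod hg b s, map_list_prod, List.map_map, ih]
    rfl

theorem binarySeries_nonterminal (hg : ∀ (A : g.NT) (w : List T), (parseTrees g A w).Finite)
    (a b : T) (X : g.NT) : binarySeries g a b [.nonterminal X] =
      ∑ x : {x : List (Symbol T g.NT) // ⟨X, x⟩ ∈ g.rules}, binarySeries g a b x.1 := by
  ext m n
  simp only [map_sum, coeff_coeff_binarySeries]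
  split_ifs with h
  · simp
  · simp [forestCount_nonterminal hg]

theorem binarySeries_terminal (a b t : T) [Decidable (t = b)] :
    binarySeries g a b [.terminal t] = if t = b then PowerSeries.X else 0 := by
  classical
  ext m n
  rw [coeff_coeff_binarySeries]
  rcases m with _ | m
  · rw [if_pos rfl]; split_ifs <;> simp
  rw [if_neg m.succ_ne_zero, forestCount_terminal]
  by_cases h : n = 0 ∧ m = 0 ∧ t = b
  · obtain ⟨rfl, rfl, rfl⟩ := h
    simp
  · rw [if_neg]
    · split_ifs with h2
      · rw [PowerSeries.coeff_X]
        split_ifs with h3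
        · rw [PowerSeries.coeff_one, if_neg fun h0 => h ⟨h0, by omega, h2⟩, Nat.cast_zero]
        · simp
      · simp
    · intro h1
      have h3 := congrArg List.length h1
      simp only [List.length_append, List.length_replicate, List.length_singleton] at h3
      obtain ⟨rfl, rfl⟩ : n = 0 ∧ m = 0 := by omega
      refine h ⟨rfl, rfl, ?_⟩
      simpa using h1.symm

theorem binarySeries_of_not_productive (a b : T) {X : g.NT} (hX : ¬ Productive g X) :
    binarySeries g a b [.nonterminal X] = 0 := by
  ext m n
  simp [coeff_coeff_binarySeries, forestCount_of_not_productive hX]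

end Series

/-! ### Finite sums of products of one-variable series -/

section FiniteRank

/-- Sums of products of a power series in the inner and one in the outer variable. -/
noncomputable def separable : Subalgebra (ZMod 2) (PowerSeries (PowerSeries (ZMod 2))) :=
  innerHom.range ⊔ outerHom.range

/-- Polynomials in both variables. -/
noncomputable def polynomials : Subalgebra (ZMod 2) (PowerSeries (PowerSeries (ZMod 2))) :=
  Algebra.adjoin (ZMod 2) {innerHom PowerSeries.X, outerHom PowerSeries.X}

theorem polynomials_le_separable : polynomials ≤ separable := by
  refine Algebra.adjoin_le ?_
  rintro _ (rfl | rfl)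
  · exact (le_sup_left : innerHom.range ≤ separable) ⟨_, rfl⟩
  · exact (le_sup_right : outerHom.range ≤ separable) ⟨_, rfl⟩

/-- Each row of `P(x) Q(y)` is a scalar multiple of `Q`, and there are only two scalars; finiteness
survives sums. -/
theorem finite_rows_of_mem_separable {G : PowerSeries (PowerSeries (ZMod 2))} (hG : G ∈ separable) :
    (Set.range fun n m => PowerSeries.coeff n (PowerSeries.coeff m G)).Finite := by
  rw [separable, ← Subalgebra.mem_toSubmodule, ← Subalgebra.mul_toSubmodule] at hG
  induction hG using Submodule.mul_induction_on' with
  | mem_mul_mem x hx y hy =>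
    obtain ⟨P, rfl⟩ := hx
    obtain ⟨Q, rfl⟩ := hy
    refine (Set.finite_range fun (c : ZMod 2) m => c * PowerSeries.coeff m Q).subset ?_
    rintro _ ⟨n, rfl⟩
    refine ⟨PowerSeries.coeff n P, funext fun m => ?_⟩
    change _ = PowerSeries.coeff n (PowerSeries.coeff m (innerHom P * outerHom Q))
    rw [innerHom_apply, PowerSeries.coeff_C_mul, coeff_outerHom, PowerSeries.coeff_mul_C]
  | add x hx y hy h1 h2 =>
    refine (h1.image2 (· + ·) h2).subset ?_
    rintro _ ⟨n, rfl⟩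
    refine ⟨_, ⟨n, rfl⟩, _, ⟨n, rfl⟩, funext fun m => ?_⟩
    simp

end FiniteRank

/-! ### Clearing denominators -/

section Main

variable {T : Type*} {g : ContextFreeGrammar T}

/-- The linear system only places the series in a field generated by one-letter series. Algebraicity
turns that field into a ring over `GF(2)(x, y)`, so the only denominators left are polynomials. -/
theorem exists_mul_mem_separable (hg : ∀ (A : g.NT) (w : List T), (parseTrees g A w).Finite)
    (a b : T) (X : g.NT) : ∃ s ∈ polynomials, s ≠ 0 ∧
      s * (innerHom (unarySeries g a [.nonterminal X]) + binarySeries g a b [.nonterminal X]) ∈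
        separable := by
  classical
  let R := PowerSeries (PowerSeries (ZMod 2))
  let K := FractionRing R
  let i : R →ₐ[ZMod 2] K := IsScalarTower.toAlgHom (ZMod 2) R K
  have hi : Function.Injective i := IsFractionRing.injective R K
  let k : IntermediateField (ZMod 2) K :=
    IntermediateField.adjoin (ZMod 2) {i (innerHom PowerSeries.X), i (outerHom PowerSeries.X)}
  let p : Symbol T g.NT → R := fun x => innerHom (unarySeries g a [x])
  let q : Symbol T g.NT → R := fun x => outerHom (unarySeries g b [x])
  let N : Symbol T g.NT → R := fun x => binarySeries g a b [x]
  -- At the constant term both one-letter series become the parity of the number of empty parses, so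
  -- the determinants can be compared with that of `z`.
  let ε : R →+* ZMod 2 := PowerSeries.constantCoeff.comp PowerSeries.constantCoeff
  let z : Symbol T g.NT → ZMod 2 := fun x => (forestCount g [x] [] : ZMod 2)
  have hεp : ε ∘ p = z := by
    ext x
    change PowerSeries.constantCoeff (PowerSeries.constantCoeff (innerHom _)) = _
    rw [innerHom_apply, PowerSeries.constantCoeff_C]
    exact constantCoeff_unarySeries a [x]
  have hεq : ε ∘ q = z := by
    ext x
    change PowerSeries.constantCoeff (PowerSeries.constantCoeff (outerHom _)) = _
    rw [← PowerSeries.coeff_zero_eq_constantCoeff_apply (outerHom _), coeff_outerHom,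
      PowerSeries.constantCoeff_C, PowerSeries.coeff_zero_eq_constantCoeff_apply]
    exact constantCoeff_unarySeries b [x]
  have hdet : ∀ p q : Symbol T g.NT → R, ε ∘ p = z → ε ∘ q = z →
      (1 - jacobian g (i ∘ p) (i ∘ q)).det ≠ 0 := by
    intro p q hp hq h
    have h1 := map_det_one_sub_jacobian (i : R →+* K) p q
    change _ = (1 - jacobian g (i ∘ p) (i ∘ q)).det at h1
    rw [h, RingHom.coe_coe, map_eq_zero_iff i hi] at h1
    have h2 := map_det_one_sub_jacobian ε p q
    rw [h1, map_zero, hp, hq] at h2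
    exact det_one_sub_jacobian_ne_zero hg z
      (fun x hx => nullable_of_forestCount_ne_zero fun h => hx (by simp [z, h])) h2.symm
  have hp : ∀ x, IsAlgebraic k ((i ∘ p) x) := by
    refine isAlgebraic_of_grammar (i ∘ p) (fun X => ?_) (fun t => ?_) (fun X hX => ?_)
      (hdet p p hεp hεp)
    · simp only [Function.comp_apply, p, unarySeries_nonterminal hg, map_sum]
      refine Finset.sum_congr rfl fun x _ => ?_
      rw [unarySeries_eq_prod hg, map_list_prod, map_list_prod, List.map_map, List.map_map]
      rfl
    · simp only [Function.comp_apply, p, unarySeries_terminal]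
      split_ifs
      · exact ⟨⟨i (innerHom PowerSeries.X), IntermediateField.subset_adjoin _ _ (by simp)⟩, rfl⟩
      · exact ⟨0, by simp⟩
    · simp only [Function.comp_apply, p, unarySeries_of_not_productive a hX, map_zero]
  have hq : ∀ x, IsAlgebraic k ((i ∘ q) x) := by
    refine isAlgebraic_of_grammar (i ∘ q) (fun X => ?_) (fun t => ?_) (fun X hX => ?_)
      (hdet q q hεq hεq)
    · simp only [Function.comp_apply, q, unarySeries_nonterminal hg, map_sum]
      refine Finset.sum_congr rfl fun x _ => ?_
      rw [unarySeries_eq_prod hg, map_list_prod, map_list_prod, List.map_map, List.map_map]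
      rfl
    · simp only [Function.comp_apply, q, unarySeries_terminal]
      split_ifs
      · exact ⟨⟨i (outerHom PowerSeries.X), IntermediateField.subset_adjoin _ _ (by simp)⟩, rfl⟩
      · exact ⟨0, by simp⟩
    · simp only [Function.comp_apply, q, unarySeries_of_not_productive b hX, map_zero]
  let A : Set K := Set.range (i ∘ p) ∪ Set.range (i ∘ q)
  -- Algebraicity enters here: inverses of ring elements are polynomial expressions in the
  -- generators.
  have hA : (IntermediateField.adjoin k A).toSubalgebra = Algebra.adjoin k A := by
    refine IntermediateField.adjoin_toSubalgebra_of_isAlgebraic ?_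
    rintro _ (⟨x, rfl⟩ | ⟨x, rfl⟩)
    exacts [hp x, hq x]
  have hpA : ∀ x, (i ∘ p) x ∈ IntermediateField.adjoin k A := fun x =>
    IntermediateField.subset_adjoin _ _ (Or.inl ⟨x, rfl⟩)
  have hqA : ∀ x, (i ∘ q) x ∈ IntermediateField.adjoin k A := fun x =>
    IntermediateField.subset_adjoin _ _ (Or.inr ⟨x, rfl⟩)
  let N' : Symbol T g.NT → R := fun x =>
    match x with
    | .terminal t => N (.terminal t)
    | .nonterminal _ => 0
  have hN'A : ∀ x, (i ∘ N') x ∈ IntermediateField.adjoin k A := by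
    rintro (t | Y)
    · simp only [Function.comp_apply, N', N, binarySeries_terminal]
      split_ifs
      · rw [← outerHom_X]
        exact (IntermediateField.adjoin k A).algebraMap_mem
          ⟨i (outerHom PowerSeries.X), IntermediateField.subset_adjoin _ _ (by simp)⟩
      · rw [map_zero]; exact zero_mem _
    · simp only [Function.comp_apply, N', map_zero]; exact zero_mem _
  have hN : ∀ X : {A : g.NT // Productive g A},
      i (N (.nonterminal X.1)) ∈ IntermediateField.adjoin k A := by
    refine mem_of_eq_sum_add _ (hdet p q hεp hεq) (c := fun X =>
      ∑ x : {x : List (Symbol T g.NT) // ⟨X.1, x⟩ ∈ g.rules},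
        leibniz (i ∘ p) (i ∘ q) (i ∘ N') x.1) (fun X => ?_) (fun X Y => jacobian_mem _ hpA hqA X Y)
      (fun X => sum_mem fun x _ => leibniz_mem _ hpA hqA hN'A _)
    have := system_eq (i ∘ p) (i ∘ q) (i ∘ N) (i ∘ N') (fun X => ?_) (fun _ => map_zero i)
      (fun _ => rfl) (fun X hX => ?_) X
    · exact this
    · simp only [Function.comp_apply, N, binarySeries_nonterminal hg, map_sum]
      refine Finset.sum_congr rfl fun x _ => ?_
      rw [binarySeries_eq_leibniz hg]
      exact map_leibniz (i : R →+* K) _ _ _ _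
    · simp only [Function.comp_apply, N, binarySeries_of_not_productive a b hX, map_zero]
  have hF : i (p (.nonterminal X) + N (.nonterminal X)) ∈ Algebra.adjoin k A := by
    rw [← hA, map_add]
    refine add_mem (hpA _) ?_
    by_cases hX : Productive g X
    · exact hN ⟨X, hX⟩
    · simp only [N, binarySeries_of_not_productive a b hX, map_zero]; exact zero_mem _
  have hpol : ∀ x ∈ Algebra.adjoin (ZMod 2)
      {i (innerHom PowerSeries.X), i (outerHom PowerSeries.X)}, ∃ y ∈ polynomials, i y = x := by
    intro x hx
    have h1 : ({i (innerHom PowerSeries.X), i (outerHom PowerSeries.X)} : Set K) =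
        i '' {innerHom PowerSeries.X, outerHom PowerSeries.X} := by rw [Set.image_pair]
    rw [h1, Algebra.adjoin_image] at hx
    exact hx
  have key : ∀ x ∈ Algebra.adjoin k A, ∃ s ∈ polynomials, s ≠ 0 ∧ ∃ G ∈ separable, i s * x = i G := by
    intro x hx
    induction hx using Algebra.adjoin_induction with
    | mem x hx =>
      refine ⟨1, one_mem _, one_ne_zero, ?_⟩
      rcases hx with ⟨x, rfl⟩ | ⟨x, rfl⟩
      · exact ⟨p x, (le_sup_left : innerHom.range ≤ separable) ⟨_, rfl⟩, by simp⟩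
      · exact ⟨q x, (le_sup_right : outerHom.range ≤ separable) ⟨_, rfl⟩, by simp⟩
    | algebraMap x =>
      obtain ⟨r, hr, s, hs, h⟩ := IntermediateField.mem_adjoin_iff_div.1 x.2
      obtain ⟨r, hr', rfl⟩ := hpol r hr
      obtain ⟨s, hs', rfl⟩ := hpol s hs
      -- With denominator `0` the quotient is `0` by convention, so multiplying by `1` suffices.
      by_cases h0 : s = 0
      · refine ⟨1, one_mem _, one_ne_zero, 0, zero_mem _, ?_⟩
        change i 1 * (x : K) = _
        rw [h, h0]; simp
      · refine ⟨s, hs', h0, r, polynomials_le_separable hr', ?_⟩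
        change i s * (x : K) = _
        rw [h, mul_div_cancel₀]
        rwa [Ne, map_eq_zero_iff i hi]
    | add x y _ _ hx hy =>
      obtain ⟨s, hs, hs0, G, hG, h⟩ := hx
      obtain ⟨t, ht, ht0, H, hH, h'⟩ := hy
      refine ⟨s * t, mul_mem hs ht, mul_ne_zero hs0 ht0, t * G + s * H,
        add_mem (mul_mem (polynomials_le_separable ht) hG)
          (mul_mem (polynomials_le_separable hs) hH), ?_⟩
      rw [map_add, map_mul, map_mul, map_mul, ← h, ← h']
      ring
    | mul x y _ _ hx hy =>
      obtain ⟨s, hs, hs0, G, hG, h⟩ := hx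
      obtain ⟨t, ht, ht0, H, hH, h'⟩ := hy
      refine ⟨s * t, mul_mem hs ht, mul_ne_zero hs0 ht0, G * H, mul_mem hG hH, ?_⟩
      rw [map_mul, map_mul, ← h, ← h']
      ring
  obtain ⟨s, hs, hs0, G, hG, h⟩ := key _ hF
  refine ⟨s, hs, hs0, ?_⟩
  rw [← map_mul] at h
  exact hi h ▸ hG

end Main

/-! ### From finite rank to rationality and periodicity -/

section Rationality

open Filter

/-- Every power of either variable occurs in finitely many monomials only. -/
def FiniteLines (G : PowerSeries (PowerSeries (ZMod 2))) : Prop :=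
  (∀ n, ∀ᶠ m in atTop, PowerSeries.coeff n (PowerSeries.coeff m G) = 0) ∧
    ∀ m, ∀ᶠ n in atTop, PowerSeries.coeff n (PowerSeries.coeff m G) = 0

theorem FiniteLines.polynomials_mul {s : PowerSeries (PowerSeries (ZMod 2))}
    (hs : s ∈ polynomials) {G : PowerSeries (PowerSeries (ZMod 2))} (hG : FiniteLines G) :
    FiniteLines (s * G) := by
  induction hs using Algebra.adjoin_induction generalizing G with
  | mem x hx =>
    rcases hx with rfl | rfl
    · refine ⟨fun n => ?_, fun m => ?_⟩
      · rcases n with _ | n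
        · exact Eventually.of_forall fun m => by
            rw [innerHom_apply, PowerSeries.coeff_C_mul, PowerSeries.coeff_zero_X_mul]
        · filter_upwards [hG.1 n] with m hm
          rw [innerHom_apply, PowerSeries.coeff_C_mul, PowerSeries.coeff_succ_X_mul, hm]
      · filter_upwards [(tendsto_sub_atTop_nat 1).eventually (hG.2 m), eventually_ge_atTop 1]
          with n hn hn1
        obtain ⟨n, rfl⟩ := Nat.exists_eq_add_of_le' hn1
        rw [innerHom_apply, PowerSeries.coeff_C_mul, PowerSeries.coeff_succ_X_mul]
        exact hn
    · rw [outerHom_X]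
      refine ⟨fun n => ?_, fun m => ?_⟩
      · filter_upwards [(tendsto_sub_atTop_nat 1).eventually (hG.1 n), eventually_ge_atTop 1]
          with m hm hm1
        obtain ⟨m, rfl⟩ := Nat.exists_eq_add_of_le' hm1
        rw [PowerSeries.coeff_succ_X_mul]
        exact hm
      · rcases m with _ | m
        · exact Eventually.of_forall fun n => by rw [PowerSeries.coeff_zero_X_mul, map_zero]
        · filter_upwards [hG.2 m] with n hn
          rw [PowerSeries.coeff_succ_X_mul, hn]
  | algebraMap c =>
    rw [← Algebra.smul_def]
    refine ⟨fun n => ?_, fun m => ?_⟩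
    · filter_upwards [hG.1 n] with m hm
      simp [hm]
    · filter_upwards [hG.2 m] with n hn
      simp [hn]
  | add x y _ _ hx hy =>
    rw [add_mul]
    refine ⟨fun n => ?_, fun m => ?_⟩
    · filter_upwards [(hx hG).1 n, (hy hG).1 n] with m h1 h2
      rw [map_add, map_add, h1, h2, add_zero]
    · filter_upwards [(hx hG).2 m, (hy hG).2 m] with n h1 h2
      rw [map_add, map_add, h1, h2, add_zero]
  | mul x y _ _ hx hy =>
    rw [mul_assoc]
    exact hx (hy hG)

/-- The embedding of power series with polynomial coefficients. -/
noncomputable def coeffEmbedding :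
    PowerSeries (Polynomial (ZMod 2)) →+* PowerSeries (PowerSeries (ZMod 2)) :=
  PowerSeries.map Polynomial.coeToPowerSeries.ringHom

theorem coeff_coeff_coeffEmbedding (G : PowerSeries (Polynomial (ZMod 2))) (n m : ℕ) :
    PowerSeries.coeff n (PowerSeries.coeff m (coeffEmbedding G)) =
      (PowerSeries.coeff m G).coeff n := by
  rw [coeffEmbedding, PowerSeries.coeff_map, Polynomial.coeToPowerSeries.ringHom_apply,
    Polynomial.coeff_coe]

theorem coeffEmbedding_injective : Function.Injective coeffEmbedding := by
  intro G H h
  ext m n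
  rw [← coeff_coeff_coeffEmbedding, h, coeff_coeff_coeffEmbedding]

/-- Polynomial coefficients in the inner variable are what makes the later substitution of `1`
meaningful. -/
theorem exists_coeffEmbedding_eq {G : PowerSeries (PowerSeries (ZMod 2))} (hG : FiniteLines G) :
    ∃ H, coeffEmbedding H = G := by
  choose D hD using fun m => eventually_atTop.1 (hG.2 m)
  refine ⟨PowerSeries.mk fun m => PowerSeries.trunc (D m) (PowerSeries.coeff m G), ?_⟩
  ext m n
  rw [coeff_coeff_coeffEmbedding, PowerSeries.coeff_mk, PowerSeries.coeff_trunc]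
  split_ifs with h
  · rfl
  · exact (hD m n (not_lt.1 h)).symm

theorem exists_coe_of_mem_polynomials {s : PowerSeries (PowerSeries (ZMod 2))}
    (hs : s ∈ polynomials) :
    ∃ r : Polynomial (Polynomial (ZMod 2)), coeffEmbedding (r : PowerSeries _) = s := by
  induction hs using Algebra.adjoin_induction with
  | mem x hx =>
    rcases hx with rfl | rfl
    · refine ⟨Polynomial.C Polynomial.X, ?_⟩
      rw [Polynomial.coe_C, coeffEmbedding, PowerSeries.map_C, innerHom_apply]
      simp
    · refine ⟨Polynomial.X, ?_⟩
      rw [Polynomial.coe_X, coeffEmbedding, PowerSeries.map_X, outerHom_X]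
  | algebraMap c =>
    refine ⟨Polynomial.C (Polynomial.C c), ?_⟩
    rw [Polynomial.coe_C, coeffEmbedding, PowerSeries.map_C]
    simp [PowerSeries.algebraMap_apply]
  | add x y _ _ hx hy =>
    obtain ⟨r, rfl⟩ := hx
    obtain ⟨r', rfl⟩ := hy
    exact ⟨r + r', by rw [Polynomial.coe_add, map_add]⟩
  | mul x y _ _ hx hy =>
    obtain ⟨r, rfl⟩ := hx
    obtain ⟨r', rfl⟩ := hy
    exact ⟨r * r', by rw [Polynomial.coe_mul, map_mul]⟩

theorem exists_coe_of_mem_separable {G : PowerSeries (PowerSeries (ZMod 2))} (hG : FiniteLines G)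
    (hG' : G ∈ separable) :
    ∃ r : Polynomial (Polynomial (ZMod 2)), coeffEmbedding (r : PowerSeries _) = G := by
  obtain ⟨H, rfl⟩ := exists_coeffEmbedding_eq hG
  -- Each row is eventually zero and only finitely many distinct rows occur, so one bound on the
  -- outer exponent works for all of them.
  have h : ∀ᶠ m in atTop, ∀ r ∈ Set.range fun n m =>
      PowerSeries.coeff n (PowerSeries.coeff m (coeffEmbedding H)), r m = 0 := by
    refine (eventually_all_finite (finite_rows_of_mem_separable hG')).2 ?_
    rintro _ ⟨n, rfl⟩
    exact hG.1 n
  obtain ⟨D, hD⟩ := eventually_atTop.1 h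
  refine ⟨PowerSeries.trunc D H, congrArg _ ?_⟩
  ext m n
  rw [Polynomial.coeff_coe, PowerSeries.coeff_trunc]
  split_ifs with h
  · rfl
  · rw [← coeff_coeff_coeffEmbedding, Polynomial.coeff_zero]
    exact (hD m (not_lt.1 h) _ ⟨n, rfl⟩).symm

/-- Substituting `c` directly could annihilate `s`. The largest power of `X - c` dividing `s` also
divides `q`, and is cancelled first. -/
theorem exists_mul_map_eval_eq {F : Type*} [Field F] (c : F) (G : PowerSeries (Polynomial F))
    (s q : Polynomial (Polynomial F)) (hs : s ≠ 0) (h : (s : PowerSeries (Polynomial F)) * G = q) :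
    ∃ s' q' : Polynomial F, s' ≠ 0 ∧
      (s' : PowerSeries F) * PowerSeries.map (Polynomial.evalRingHom c) G = q' := by
  let t : Polynomial F := Polynomial.X - Polynomial.C c
  have ht : Prime (Polynomial.C t) := Polynomial.prime_C_iff.2 (Polynomial.prime_X_sub_C c)
  obtain ⟨s₁, hs₁, hnd⟩ :=
    (FiniteMultiplicity.of_prime_left ht hs).exists_eq_pow_mul_and_not_dvd
  set e := multiplicity (Polynomial.C t) s
  have hq : Polynomial.C (t ^ e) ∣ q := by
    rw [Polynomial.C_dvd_iff_dvd_coeff]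
    intro i
    rw [← Polynomial.coeff_coe, ← h, hs₁, Polynomial.coe_mul, ← Polynomial.C_pow, mul_assoc,
      Polynomial.coe_C, PowerSeries.coeff_C_mul]
    exact dvd_mul_right _ _
  obtain ⟨q₁, rfl⟩ := hq
  have h1 : (s₁ : PowerSeries (Polynomial F)) * G = q₁ := by
    have h0 : PowerSeries.C (t ^ e) ≠ 0 := by
      rw [Ne, map_eq_zero_iff _ PowerSeries.C_injective]
      exact pow_ne_zero _ (Polynomial.X_sub_C_ne_zero c)
    refine mul_left_cancel₀ h0 ?_
    rw [hs₁] at h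
    rw [← mul_assoc, ← Polynomial.coe_C, ← Polynomial.coe_mul, ← Polynomial.coe_mul, ← h,
      Polynomial.C_pow]
  refine ⟨s₁.map (Polynomial.evalRingHom c), q₁.map (Polynomial.evalRingHom c), ?_, ?_⟩
  · intro h0
    refine hnd ?_
    rw [Polynomial.C_dvd_iff_dvd_coeff]
    intro i
    rw [Polynomial.dvd_iff_isRoot]
    have := congrArg (fun p => Polynomial.coeff p i) h0
    simpa using this
  · rw [Polynomial.polynomial_map_coe, Polynomial.polynomial_map_coe, ← map_mul, h1]

/-- The quotient ring modulo `s` is finite, so two powers of `X` agree in it and `s` divides some `X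
^ i - X ^ j` with `i < j`. Hence `(X ^ i - X ^ j) φ` is a polynomial. -/
theorem eventually_periodic_of_mul_eq {F : Type*} [Field F] [Finite F] (φ : PowerSeries F)
    (s q : Polynomial F) (hs : s ≠ 0) (h : (s : PowerSeries F) * φ = q) :
    ∃ d > 0, ∃ M, ∀ m ≥ M, PowerSeries.coeff (m + d) φ = PowerSeries.coeff m φ := by
  have : Module.Finite F (AdjoinRoot s) := (AdjoinRoot.powerBasis hs).finite
  have : Finite (AdjoinRoot s) := Module.finite_of_finite F
  obtain ⟨i, j, hij, h1⟩ := Finite.exists_ne_map_eq_of_infinite fun i : ℕ =>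
    AdjoinRoot.mk s (Polynomial.X ^ i)
  wlog hlt : i < j generalizing i j
  · exact this j i hij.symm h1.symm (by omega)
  obtain ⟨u, hu⟩ := AdjoinRoot.mk_eq_mk.1 h1
  have h2 : (PowerSeries.X ^ i - PowerSeries.X ^ j) * φ = ((u * q : Polynomial F) : PowerSeries F) := by
    rw [Polynomial.coe_mul, ← h, ← mul_assoc, ← Polynomial.coe_mul, mul_comm u, ← hu]
    simp
  refine ⟨j - i, by omega, (u * q).natDegree + 1, fun m hm => ?_⟩
  have h3 := congrArg (PowerSeries.coeff (m + j)) h2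
  rw [Polynomial.coeff_coe, Polynomial.coeff_eq_zero_of_natDegree_lt (by omega), sub_mul, map_sub,
    show PowerSeries.coeff (m + j) (PowerSeries.X ^ j * φ) = PowerSeries.coeff m φ from
      PowerSeries.coeff_X_pow_mul _ _ _, show m + j = m + (j - i) + i by omega,
    PowerSeries.coeff_X_pow_mul, sub_eq_zero] at h3
  exact h3

/-- Elements below `M` are one-term progressions; each element in the window `[M, M + d)` starts a
progression with difference `d`. -/
theorem isFiniteUnion_of_eventually_periodic {S : Set ℕ} {d M : ℕ}
    (h : ∀ m ≥ M, m + d ∈ S ↔ m ∈ S) (hd : 0 < d) : IsFiniteUnionOfArithmeticProgressions S := by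
  classical
  have hk : ∀ k, ∀ m ≥ M, m + k * d ∈ S ↔ m ∈ S := by
    intro k m hm
    induction k with
    | zero => simp
    | succ k ih => rw [← ih, ← h (m + k * d) (by omega)]; ring_nf
  refine ⟨((Finset.range M).filter (· ∈ S)).image (fun c => (c, 0)) ∪
    ((Finset.Ico M (M + d)).filter (· ∈ S)).image (fun c => (c, d)), Set.ext fun m => ?_⟩
  simp only [Set.mem_iUnion, exists_prop, Finset.mem_union, Finset.mem_image, Finset.mem_filter,
    Finset.mem_range, Finset.mem_Ico, arithmeticProgression, Set.mem_ofPred_eq]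
  constructor
  · intro hm
    by_cases hM : m < M
    · exact ⟨(m, 0), Or.inl ⟨m, ⟨hM, hm⟩, rfl⟩, 0, by simp⟩
    · have h1 : M + (m - M) % d + (m - M) / d * d = m := by
        have := Nat.mod_add_div' (m - M) d
        omega
      refine ⟨(M + (m - M) % d, d), Or.inr ⟨_, ⟨⟨by omega, ?_⟩, ?_⟩, rfl⟩, (m - M) / d, h1.symm⟩
      · have := Nat.mod_lt (m - M) hd
        omega
      · rwa [← hk ((m - M) / d) _ (by omega), h1]
  · rintro ⟨_, ⟨c, ⟨_, hc⟩, rfl⟩ | ⟨c, ⟨hcM, hc⟩, rfl⟩, k, rfl⟩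
    · simpa using hc
    · exact (hk k c hcM.1).2 hc

end Rationality

/-! ### Application to the language of the theorem -/

theorem coeff_coeff_language {T : Type*} (G : GF2Grammar T) (a b : T) (n m : ℕ)
    [Decidable (List.replicate n a ++ List.replicate m b ∈ G.language)] :
    PowerSeries.coeff n (PowerSeries.coeff m
      (innerHom (unarySeries G.ordinary a [.nonterminal G.ordinary.initial]) +
        binarySeries G.ordinary a b [.nonterminal G.ordinary.initial])) =
      if List.replicate n a ++ List.replicate m b ∈ G.language then 1 else 0 := by
  have h1 : PowerSeries.coeff n (PowerSeries.coeff m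
      (innerHom (unarySeries G.ordinary a [.nonterminal G.ordinary.initial]) +
        binarySeries G.ordinary a b [.nonterminal G.ordinary.initial])) =
      (forestCount G.ordinary [.nonterminal G.ordinary.initial]
        (List.replicate n a ++ List.replicate m b) : ZMod 2) := by
    rw [map_add, map_add, coeff_coeff_binarySeries, innerHom_apply, PowerSeries.coeff_C]
    split_ifs with h
    · subst h; simp [unarySeries]
    · simp
  have h2 : List.replicate n a ++ List.replicate m b ∈ G.language ↔
      Odd (forestCount G.ordinary [.nonterminal G.ordinary.initial]
        (List.replicate n a ++ List.replicate m b)) := Iff.rfl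
  rw [h1]
  split_ifs with h
  · exact ZMod.natCast_eq_one_iff_odd.2 (h2.1 h)
  · exact ZMod.natCast_eq_zero_iff_even.2 (Nat.not_odd_iff_even.1 fun h' => h (h2.2 h'))

theorem replicate_append_replicate_inj {T : Type*} {a b : T} (hab : a ≠ b) {n m n' m' : ℕ}
    (h : List.replicate n a ++ List.replicate m b = List.replicate n' a ++ List.replicate m' b) :
    n = n' ∧ m = m' := by
  classical
  have h1 := congrArg (List.count a) h
  have h2 := congrArg (List.count b) h
  simp only [List.count_append, List.count_replicate, beq_iff_eq, hab, hab.symm, if_true,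
    if_false, add_zero, zero_add] at h1 h2
  exact ⟨h1, h2⟩

theorem theorem3p4 {T : Type*} [Finite T] (a b : T) (hab : a ≠ b)
    (n₀ : ℕ) (hn₀ : n₀ = 0 ∨ n₀ = 1)
    (f : ℕ → ℕ) (hf : StrictMonoOn f (Set.Ici n₀))
    (hL : IsDescribedByGF2Grammar
      ({w | ∃ n : ℕ, n₀ ≤ n ∧ w = List.replicate n a ++ List.replicate (f n) b} : Language T)) :
    IsFiniteUnionOfArithmeticProgressions (f '' Set.Ici n₀) := by
  classical
  obtain ⟨G, hG⟩ := hL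
  obtain ⟨s, hs, hs0, hsep⟩ := exists_mul_mem_separable G.finite_parseTrees a b G.ordinary.initial
  set F := innerHom (unarySeries G.ordinary a [.nonterminal G.ordinary.initial]) +
        binarySeries G.ordinary a b [.nonterminal G.ordinary.initial] with hF
  have hcoeff : ∀ n m, PowerSeries.coeff n (PowerSeries.coeff m F) =
      if n₀ ≤ n ∧ f n = m then 1 else 0 := by
    intro n m
    rw [hF, coeff_coeff_language]
    refine if_congr ?_ rfl rfl
    rw [hG]
    constructor
    · rintro ⟨n', hn', h⟩
      obtain ⟨rfl, rfl⟩ := replicate_append_replicate_inj hab h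
      exact ⟨hn', rfl⟩
    · rintro ⟨hn, rfl⟩
      exact ⟨n, hn, rfl⟩
  have hlines : FiniteLines F := by
    refine ⟨fun n => ?_, fun m => ?_⟩
    · filter_upwards [Filter.eventually_gt_atTop (f n)] with m hm
      rw [hcoeff, if_neg fun h => hm.ne h.2]
    · by_cases h : ∃ n, n₀ ≤ n ∧ f n = m
      · obtain ⟨n, hn, rfl⟩ := h
        filter_upwards [Filter.eventually_gt_atTop n] with n' hn'
        rw [hcoeff, if_neg fun h => hn'.ne (hf.injOn hn h.1 h.2.symm)]
      · exact Filter.Eventually.of_forall fun n => by rw [hcoeff, if_neg fun h' => h ⟨n, h'⟩]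
  obtain ⟨q, hq⟩ := exists_coe_of_mem_separable (hlines.polynomials_mul hs) hsep
  obtain ⟨r, rfl⟩ := exists_coe_of_mem_polynomials hs
  obtain ⟨H, hH⟩ := exists_coeffEmbedding_eq hlines
  have hr : r ≠ 0 := by rintro rfl; exact hs0 (by simp)
  -- At `x = 1` the coefficient of `y ^ m` becomes the parity of the number of preimages of `m`
  -- under `f`, which is the indicator of the image.
  obtain ⟨s', q', hs', h⟩ := exists_mul_map_eval_eq 1 H r q hr
    (coeffEmbedding_injective (by rw [map_mul, hH, hq]))
  have hval : ∀ m, PowerSeries.coeff m (PowerSeries.map (Polynomial.evalRingHom 1) H) =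
      if m ∈ f '' Set.Ici n₀ then 1 else 0 := by
    intro m
    rw [PowerSeries.coeff_map]
    split_ifs with hm
    · obtain ⟨n, hn, rfl⟩ := hm
      have : PowerSeries.coeff (f n) H = Polynomial.X ^ n := by
        ext n'
        rw [← coeff_coeff_coeffEmbedding, hH, hcoeff, Polynomial.coeff_X_pow]
        refine if_congr ⟨fun h => hf.injOn h.1 hn h.2, ?_⟩ rfl rfl
        rintro rfl
        exact ⟨hn, rfl⟩
      rw [this]; simp
    · have : PowerSeries.coeff m H = 0 := by
        ext n'
        rw [← coeff_coeff_coeffEmbedding, hH, hcoeff, Polynomial.coeff_zero, if_neg]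
        exact fun h => hm ⟨n', h.1, h.2⟩
      rw [this, map_zero]
  obtain ⟨d, hd, M, hM⟩ := eventually_periodic_of_mul_eq _ s' q' hs' h
  refine isFiniteUnion_of_eventually_periodic (M := M) (fun m hm => ?_) hd
  have := hM m hm
  rw [hval, hval] at this
  split_ifs at this with h1 h2 h2
  · exact iff_of_true h1 h2
  · exact absurd this one_ne_zero
  · exact absurd this zero_ne_one
  · exact iff_of_false h1 h2
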